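/- Let $k\ge 0$ be an integer, let $X\sim\mathcal N(0,\mathrm{Id}_k)$ be a standard normal random vector in $\mathbb R^k$ and, for a Lipschitz function $F:\mathbb R^k\to\mathbb R$, let $\mathrm{Lip}(F)$ denote its smallest Lipschitz constant with respect to the Euclidean norm. (i) For every Lipschitz $F:\mathbb R^k\to\mathbb R$, the random variable $F(X)$ is integrable and $F(X)-\mathbb E F(X)$ is sub-Gaussian with parameter $\mathrm{Lip}(F)$, that is, $$\mathbb E\left(e^{u(F(X)-\mathbb E F(X))}\right)\le e^{\frac{1}{2}\mathrm{Lip}(F)^2u^2}\qquad\text{for all }u\in\mathbb R .$$ (ii) For every Lipschitz $F:\mathbb R^k\to\mathbb R$ and every $\tau>0$, $$P\left(|F(X)-\mathbb E F(X)|>\tau\right)\le 2\exp\left(-\frac{\tau^2}{2\,\mathrm{Lip}(F)^2}\right),$$ where the right-hand side is read as $0$ if $\mathrm{Lip}(F)=0$. (iii) The constant $1/2$ is optimal in every dimension $k\ge1$: a real number $C$ has the property that $$P\left(|F(X)-\mathbb E F(X)|>\tau\right)\le 2\exp\left(-\frac{C\tau^2}{\mathrm{Lip}(F)^2}\right)$$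 for all Lipschitz $F:\mathbb R^k\to\mathbb R$ with $\mathrm{Lip}(F)>0$ and all $\tau>0$ if and only if $C\le 1/2$. -/

import Mathlib

open MeasureTheory ProbabilityTheory
open scoped NNReal

/-- The Lipschitz constant `Lip(F)` of `F : ℝᵏ → ℝ` with respect to the Euclidean norm: the
infimum of all admissible constants (used only for Lipschitz `F`, where the set is nonempty and
the infimum is attained). -/
noncomputable def lipConst {k : ℕ} (F : EuclideanSpace ℝ (Fin k) → ℝ) : ℝ≥0 :=
  sInf {K : ℝ≥0 | LipschitzWith K F}

/-- `Y ∈ SubG(σ)` under `P`: `Y` is integrable, and with `μ = E[Y]` one has, for all real `u`,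
that `exp (u (Y - μ))` is integrable with `E[exp (u (Y - μ))] ≤ exp (σ² u² / 2)`. -/
def IsSubG {Ω : Type*} [MeasurableSpace Ω] (Y : Ω → ℝ) (σ : ℝ≥0) (P : Measure Ω) : Prop :=
  Integrable Y P ∧ HasSubgaussianMGF (fun ω => Y ω - ∫ ω', Y ω' ∂P) (σ ^ 2) P

/-! The engine is Maurey's infimum-convolution inequality: if `g x ≤ f y + ‖x - y‖ ^ 2 / 2` for all
`x, y`, then `∫ exp g ≤ exp (∫ f)` under the Gaussian measure. With `f = u (F - E F)` and `g = f -
K² u² / 2` it is the sub-Gaussian bound, and Chernoff gives the tails.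

On the line, normalise `∫ exp g = 1` and let `T` carry the Gaussian density `p` monotonically to `p
* exp g` (`exists_transport`). The Jacobian equation gives `log T'`; then `log T' ≤ T' - 1` and the
hypothesis at `(T x, x)` yield `(p * (x - T))' ≤ p * f`, which integrates to `0 ≤ ∫ p * f`. The
inequality tensorizes without loss (`InfConvIneq.prod`), whence every dimension.

A coordinate function is standard normal with Lipschitz constant 1, and its tail rules out `C >
1/2`. -/

open Set Filter Topology

/-! ### Monotone transport on the line -/

/-- The distribution function of a positive continuous probability density on `ℝ` is strictly
differentiable. -/
lemma integral_Iic_hasStrictDerivAt {q : ℝ → ℝ} (hc : Continuous q) (hi : Integrable q) (x : ℝ) :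
    HasStrictDerivAt (fun y => ∫ t in Iic y, q t) (q x) x := by
  have h : (fun y => ∫ t in Iic y, q t) =
      fun y => (∫ t in Iic (0 : ℝ), q t) + ∫ t in (0)..y, q t := by
    ext y
    rw [← intervalIntegral.integral_Iic_sub_Iic hi.integrableOn hi.integrableOn]
    ring
  rw [h]
  exact (hc.integral_hasStrictDerivAt 0 x).const_add _

lemma integral_Iic_strictMono {q : ℝ → ℝ} (hc : Continuous q) (hpos : ∀ x, 0 < q x)
    (hi : Integrable q) : StrictMono (fun y => ∫ t in Iic y, q t) := by
  refine strictMono_of_deriv_pos fun x => ?_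
  rw [(integral_Iic_hasStrictDerivAt hc hi x).hasDerivAt.deriv]
  exact hpos x

lemma range_integral_Iic {q : ℝ → ℝ} (hc : Continuous q) (hpos : ∀ x, 0 < q x)
    (hi : Integrable q) : range (fun y => ∫ t in Iic y, q t) = Ioo 0 (∫ t, q t) := by
  have hmono := integral_Iic_strictMono hc hpos hi
  have hcont : Continuous (fun y => ∫ t in Iic y, q t) :=
    continuous_iff_continuousAt.2 fun x =>
      (integral_Iic_hasStrictDerivAt hc hi x).hasDerivAt.continuousAt
  have htop : Tendsto (fun y => ∫ t in Iic y, q t) atTop (𝓝 (∫ t, q t)) :=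
    (aecover_Iic tendsto_id).integral_tendsto_of_countably_generated hi
  have hbot : Tendsto (fun y => ∫ t in Iic y, q t) atBot (𝓝 0) := by
    have h1 : ∀ y, ∫ t in Iic y, q t = (∫ t, q t) - ∫ t in Ioi y, q t := fun y => by
      rw [← intervalIntegral.integral_Iic_add_Ioi (b := y) hi.integrableOn hi.integrableOn]
      ring
    have h2 : Tendsto (fun y => ∫ t in Ioi y, q t) atBot (𝓝 (∫ t, q t)) :=
      (aecover_Ioi tendsto_id).integral_tendsto_of_countably_generated hi
    simp_rw [h1]
    simpa using h2.const_sub (∫ t, q t)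
  apply Subset.antisymm
  · rintro _ ⟨y, rfl⟩
    refine ⟨?_, ?_⟩
    · exact (hmono.monotone.le_of_tendsto hbot (y - 1)).trans_lt (hmono (by linarith))
    · exact (hmono (show y < y + 1 by linarith)).trans_le (hmono.monotone.ge_of_tendsto htop (y + 1))
  · rintro c ⟨h0, h1⟩
    obtain ⟨a, ha⟩ := (hbot.eventually_lt_const h0).exists
    obtain ⟨b, hb⟩ := (htop.eventually_const_lt h1).exists
    exact mem_range_of_exists_le_of_exists_ge hcont ⟨a, ha.le⟩ ⟨b, hb.le⟩

/-- Monotone transport between two positive continuous densities of equal mass. -/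
lemma exists_transport {p q : ℝ → ℝ} (hpc : Continuous p) (hqc : Continuous q)
    (hp : ∀ x, 0 < p x) (hq : ∀ x, 0 < q x) (hpi : Integrable p) (hqi : Integrable q)
    (hpq : ∫ x, p x = ∫ x, q x) :
    ∃ T : ℝ → ℝ, Function.Injective T ∧ ∀ x, HasDerivAt T ((q (T x))⁻¹ * p x) x := by
  set P : ℝ → ℝ := fun y => ∫ t in Iic y, p t with hP
  set Q : ℝ → ℝ := fun y => ∫ t in Iic y, q t with hQ
  have hrP : range P = Ioo 0 (∫ t, p t) := range_integral_Iic hpc hp hpi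
  have hrQ : range Q = Ioo 0 (∫ t, q t) := range_integral_Iic hqc hq hqi
  have hPi : Function.Injective P := (integral_Iic_strictMono hpc hp hpi).injective
  have hQi : Function.Injective Q := (integral_Iic_strictMono hqc hq hqi).injective
  have hleft : ∀ x, Function.invFun Q (Q x) = x := Function.leftInverse_invFun hQi
  have hT : ∀ x, Q (Function.invFun Q (P x)) = P x := fun x => by
    have : P x ∈ range Q := by
      rw [hrQ, ← hpq, ← hrP]
      exact mem_range_self x
    exact Function.invFun_eq this
  refine ⟨fun x => Function.invFun Q (P x), fun x y h => ?_, fun x => ?_⟩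
  · apply hPi
    rw [← hT x, ← hT y]
    exact congrArg Q h
  -- Strict differentiability of `Q` together with a left inverse near the point suffices;
  -- continuity of the inverse need not be shown separately.
  · have h1 : HasDerivAt (Function.invFun Q) (q (Function.invFun Q (P x)))⁻¹ (P x) := by
      have := ((integral_Iic_hasStrictDerivAt hqc hqi
        (Function.invFun Q (P x))).to_local_left_inverse (hq _).ne'
        (Eventually.of_forall hleft)).hasDerivAt
      rwa [show (∫ t in Iic (Function.invFun Q (P x)), q t) = P x from hT x] at this
    exact h1.comp x (integral_Iic_hasStrictDerivAt hpc hpi x).hasDerivAt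

/-! ### Integrating a differential inequality over the line -/

/-- Otherwise `|h| ≥ ε` on a half-line of infinite measure. Thus boundary terms vanish along a
sequence, with no decay estimate for `h`. -/
lemma exists_gt_abs_lt_of_integrable {h : ℝ → ℝ} (hi : Integrable h) {ε : ℝ} (hε : 0 < ε) (a : ℝ) :
    ∃ b, a < b ∧ |h b| < ε := by
  by_contra! H
  have : IntegrableOn (fun _ : ℝ => ε) (Ioi a) := by
    refine Integrable.mono' hi.integrableOn.norm (by fun_prop) ?_
    refine (ae_restrict_iff' measurableSet_Ioi).2 (ae_of_all _ fun x hx => ?_)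
    rw [Real.norm_of_nonneg hε.le]
    exact H x hx
  simp [integrableOn_const_iff, hε.ne'] at this

/-- If `h` and `r` are integrable on `ℝ` and `h' ≤ r`, then `∫ r ≥ 0`. -/
lemma integral_nonneg_of_hasDerivAt_le {h h' r : ℝ → ℝ} (hi : Integrable h) (ri : Integrable r)
    (hd : ∀ x, HasDerivAt h (h' x) x) (hr : ∀ x, h' x ≤ r x) : 0 ≤ ∫ x, r x := by
  refine le_of_forall_pos_le_add fun ε hε => ?_
  have hb : ∀ n : ℕ, ∃ b : ℝ, (n : ℝ) < b ∧ |h b| < ε / 2 := fun n =>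
    exists_gt_abs_lt_of_integrable hi (half_pos hε) n
  have ha : ∀ n : ℕ, ∃ b : ℝ, (n : ℝ) < b ∧ |h (-b)| < ε / 2 := fun n =>
    exists_gt_abs_lt_of_integrable hi.comp_neg (half_pos hε) n
  choose b hb1 hb2 using hb
  choose a ha1 ha2 using ha
  have hbt : Tendsto b atTop atTop :=
    tendsto_atTop_mono (fun n => (hb1 n).le) tendsto_natCast_atTop_atTop
  have hat : Tendsto (fun n => -a n) atTop atBot := tendsto_neg_atTop_atBot.comp
    (tendsto_atTop_mono (fun n => (ha1 n).le) tendsto_natCast_atTop_atTop)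
  have hlim := (intervalIntegral_tendsto_integral ri hat hbt).add_const ε
  refine ge_of_tendsto' hlim fun n => ?_
  have hn : (0 : ℝ) ≤ n := n.cast_nonneg
  have := intervalIntegral.sub_le_integral_of_hasDeriv_right_of_le (a := -a n) (b := b n)
    (by linarith [ha1 n, hb1 n]) (fun x _ => (hd x).continuousAt.continuousWithinAt)
    (fun x _ => (hd x).hasDerivWithinAt) ri.integrableOn (fun x _ => hr x)
  linarith [abs_lt.1 (ha2 n), abs_lt.1 (hb2 n)]

/-! ### Exponential moments and Lipschitz functions -/

lemma LipschitzWith.abs_sub_le_mul_norm {E : Type*} [NormedAddCommGroup E] {f : E → ℝ} {K : ℝ≥0}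
    (hf : LipschitzWith K f) (x y : E) :
    |f x - f y| ≤ K * ‖x - y‖ := by
  simpa [Real.norm_eq_abs] using hf.norm_sub_le x y

lemma abs_le_exp_add_exp_neg (x : ℝ) : |x| ≤ Real.exp x + Real.exp (-x) := by
  rcases abs_cases x with ⟨h1, -⟩ | ⟨h1, -⟩ <;> rw [h1] <;>
  linarith [Real.add_one_le_exp x, Real.add_one_le_exp (-x), Real.exp_pos x, Real.exp_pos (-x)]

/-- A measure integrates all exponentials of multiples of the norm. -/
def HasExpMoments {E : Type*} [NormedAddCommGroup E] [MeasurableSpace E] (μ : Measure E) : Prop :=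
  ∀ K : ℝ, Integrable (fun x => Real.exp (K * ‖x‖)) μ

namespace HasExpMoments

variable {E : Type*} [NormedAddCommGroup E] [MeasurableSpace E] [BorelSpace E] {μ : Measure E}

lemma integrable_exp (h : HasExpMoments μ) {f : E → ℝ} {K : ℝ≥0} (hf : LipschitzWith K f) :
    Integrable (fun x => Real.exp (f x)) μ := by
  have hc := hf.continuous
  refine Integrable.mono' ((h K).const_mul (Real.exp (f 0)))
    (by fun_prop : Measurable _).aestronglyMeasurable (ae_of_all _ fun x => ?_)
  rw [Real.norm_of_nonneg (Real.exp_pos _).le, ← Real.exp_add]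
  have := le_abs_self (f x - f 0) |>.trans (hf.abs_sub_le_mul_norm x 0)
  rw [sub_zero] at this
  exact Real.exp_le_exp.2 (by linarith)

lemma integrable (h : HasExpMoments μ) {f : E → ℝ} {K : ℝ≥0} (hf : LipschitzWith K f) :
    Integrable f μ := by
  have hc := hf.continuous
  refine Integrable.mono' ((h.integrable_exp hf).add (h.integrable_exp hf.neg))
    hc.measurable.aestronglyMeasurable (ae_of_all _ fun x => ?_)
  simp only [Pi.add_apply, Pi.neg_apply, Real.norm_eq_abs]
  exact abs_le_exp_add_exp_neg (f x)

end HasExpMoments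

/-! ### The infimum-convolution inequality on the line -/

lemma hasExpMoments_gaussianReal : HasExpMoments (gaussianReal 0 1) := fun K => by
  have h1 : ∀ t : ℝ, Integrable (fun x => Real.exp (t * x)) (gaussianReal 0 1) :=
    fun t => integrable_exp_mul_gaussianReal t
  simpa [Real.norm_eq_abs] using integrable_exp_mul_abs (h1 K) (h1 (-K))

lemma integrable_gaussianReal_iff {f : ℝ → ℝ} :
    Integrable f (gaussianReal 0 1) ↔ Integrable (fun x => gaussianPDFReal 0 1 x * f x) := by
  rw [gaussianReal_of_var_ne_zero _ one_ne_zero, integrable_withDensity_iff_integrable_smul'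
    (measurable_gaussianPDF _ _) (ae_of_all _ fun _ => gaussianPDF_lt_top)]
  simp [toReal_gaussianPDF]

lemma integral_gaussianReal_eq {f : ℝ → ℝ} :
    ∫ x, f x ∂(gaussianReal 0 1) = ∫ x, gaussianPDFReal 0 1 x * f x := by
  simp [integral_gaussianReal_eq_integral_smul one_ne_zero]

lemma gaussianPDFReal_zero_one (x : ℝ) :
    gaussianPDFReal 0 1 x = (√(2 * Real.pi))⁻¹ * Real.exp (-(x ^ 2 / 2)) := by
  simp [gaussianPDFReal, neg_div]

lemma hasDerivAt_gaussianPDFReal (x : ℝ) :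
    HasDerivAt (gaussianPDFReal 0 1) (-x * gaussianPDFReal 0 1 x) x := by
  have h : gaussianPDFReal 0 1 = fun x => (√(2 * Real.pi))⁻¹ * Real.exp (-(x ^ 2 / 2)) :=
    funext gaussianPDFReal_zero_one
  have h2 : HasDerivAt (fun x : ℝ => -(x ^ 2 / 2)) (-x) x := by
    refine (((hasDerivAt_id x).pow 2).div_const 2).neg.congr_deriv ?_
    simp
  rw [h]
  refine (h2.exp.const_mul _).congr_deriv ?_
  ring

/-- Normalised one-dimensional case of the infimum-convolution inequality. -/
lemma integral_nonneg_of_infConv_gaussianReal {f g : ℝ → ℝ} {K : ℝ≥0} (hf : LipschitzWith K f)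
    (hg : LipschitzWith K g) (hfg : ∀ x y, g x ≤ f y + (x - y) ^ 2 / 2)
    (hone : ∫ x, Real.exp (g x) ∂(gaussianReal 0 1) = 1) :
    0 ≤ ∫ x, f x ∂(gaussianReal 0 1) := by
  have hgc := hg.continuous
  set p : ℝ → ℝ := gaussianPDFReal 0 1 with hp
  have hpc : Continuous p := continuous_iff_continuousAt.2 fun x =>
    (hasDerivAt_gaussianPDFReal x).continuousAt
  have hppos : ∀ x, 0 < p x := fun x => gaussianPDFReal_pos _ _ _ one_ne_zero
  have hqi : Integrable fun x => p x * Real.exp (g x) :=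
    integrable_gaussianReal_iff.1 (hasExpMoments_gaussianReal.integrable_exp hg)
  obtain ⟨T, hTinj, hTd⟩ := exists_transport hpc
    (by fun_prop : Continuous fun x => p x * Real.exp (g x)) hppos (fun x => mul_pos (hppos x) (Real.exp_pos _)) (integrable_gaussianPDFReal 0 1) hqi
    (by rw [← integral_gaussianReal_eq, hone]; exact integral_gaussianPDFReal_eq_one 0 one_ne_zero)
  -- Substitute `y = T x`: since `T' * p (T x) * exp (g (T x)) = p x`, integrability reduces to that
  -- of `p y * exp (g y) * y`.
  have hTi : Integrable fun x => p x * T x := by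
    have h1 : Integrable fun y => p y * Real.exp (g y) * y := by
      have h2 : Integrable (fun y => Real.exp (g y) * y) (gaussianReal 0 1) := by
        refine Integrable.mono' ((hasExpMoments_gaussianReal.integrable_exp
          (hg.add LipschitzWith.id)).add (hasExpMoments_gaussianReal.integrable_exp
          (hg.add LipschitzWith.id.neg)))
          (by fun_prop : Measurable _).aestronglyMeasurable (ae_of_all _ fun x => ?_)
        simp only [Pi.add_apply, id, Pi.neg_apply, Real.exp_add, ← mul_add, norm_mul,
          Real.norm_of_nonneg (Real.exp_pos (g x)).le, Real.norm_eq_abs]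
        gcongr
        exact abs_le_exp_add_exp_neg x
      simpa [mul_assoc] using integrable_gaussianReal_iff.1 h2
    have h3 := (integrableOn_image_iff_integrableOn_abs_deriv_smul MeasurableSet.univ
      (fun x _ => (hTd x).hasDerivWithinAt) hTinj.injOn (fun y => p y * Real.exp (g y) * y)).1
      h1.integrableOn
    rw [integrableOn_univ] at h3
    refine h3.congr (ae_of_all _ fun x => ?_)
    have hpos : 0 < p (T x) * Real.exp (g (T x)) := mul_pos (hppos _) (Real.exp_pos _)
    simp only [smul_eq_mul]
    rw [abs_of_pos (mul_pos (inv_pos.2 hpos) (hppos x))]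
    have := (hppos (T x)).ne'
    field_simp
  have hxi : Integrable fun x => p x * x :=
    integrable_gaussianReal_iff.1 (hasExpMoments_gaussianReal.integrable LipschitzWith.id)
  have hfi : Integrable fun x => p x * f x :=
    integrable_gaussianReal_iff.1 (hasExpMoments_gaussianReal.integrable hf)
  rw [integral_gaussianReal_eq]
  refine integral_nonneg_of_hasDerivAt_le (hxi.sub hTi) hfi
    (fun x => ((hasDerivAt_gaussianPDFReal x).mul (hasDerivAt_id x)).sub
      ((hasDerivAt_gaussianPDFReal x).mul (hTd x))) fun x => ?_
  -- The left side is `T'`, so the exponent on the right is `log T'`.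
  have hlog : (p (T x) * Real.exp (g (T x)))⁻¹ * p x
      = Real.exp (-(x ^ 2 / 2) + T x ^ 2 / 2 - g (T x)) := by
    rw [hp, gaussianPDFReal_zero_one, gaussianPDFReal_zero_one, Real.exp_sub, Real.exp_add,
      Real.exp_neg (T x ^ 2 / 2)]
    have : (0 : ℝ) < √(2 * Real.pi) := by positivity
    field_simp
  have h1 := Real.add_one_le_exp (-(x ^ 2 / 2) + T x ^ 2 / 2 - g (T x))
  rw [← hlog] at h1
  have h2 := hfg (T x) x
  have h3 : 1 - x ^ 2 + x * T x - (p (T x) * Real.exp (g (T x)))⁻¹ * p x ≤ f x := by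
    nlinarith
  have h4 := mul_le_mul_of_nonneg_left h3 (hppos x).le
  simp only [id]
  linarith

/-- One-dimensional infimum-convolution inequality for the Gaussian measure. -/
lemma integral_exp_le_of_infConv_gaussianReal {f g : ℝ → ℝ} {K : ℝ≥0} (hf : LipschitzWith K f)
    (hg : LipschitzWith K g) (hfg : ∀ x y, g x ≤ f y + (x - y) ^ 2 / 2) :
    ∫ x, Real.exp (g x) ∂(gaussianReal 0 1) ≤ Real.exp (∫ x, f x ∂(gaussianReal 0 1)) := by
  set Z := ∫ x, Real.exp (g x) ∂(gaussianReal 0 1) with hZ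
  have hZpos : 0 < Z := integral_exp_pos (hasExpMoments_gaussianReal.integrable_exp hg)
  -- Subtracting `log Z` from both `f` and `g` preserves the hypothesis and normalises `exp g`.
  have hlip : ∀ {h : ℝ → ℝ}, LipschitzWith K h → LipschitzWith K fun x => h x - Real.log Z :=
    fun hh => LipschitzWith.of_dist_le_mul fun x y => by simpa using hh.dist_le_mul x y
  have := integral_nonneg_of_infConv_gaussianReal (hlip hf) (hlip hg)
    (fun x y => by linarith [hfg x y]) (by
      simp_rw [Real.exp_sub, Real.exp_log hZpos]
      rw [integral_div, ← hZ, div_self hZpos.ne'])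
  rw [integral_sub (hasExpMoments_gaussianReal.integrable hf) (integrable_const _)] at this
  simp only [integral_const, probReal_univ, smul_eq_mul, one_mul, sub_nonneg] at this
  exact (Real.log_le_iff_le_exp hZpos).1 this

/-! ### Tensorization and transfer -/

/-- The infimum-convolution inequality for `μ` with respect to the cost `c`, tested on Lipschitz
functions. -/
def InfConvIneq {E : Type*} [NormedAddCommGroup E] [MeasurableSpace E] (μ : Measure E)
    (c : E → E → ℝ) : Prop :=
  ∀ (f g : E → ℝ) (K : ℝ≥0), LipschitzWith K f → LipschitzWith K g →
    (∀ x y, g x ≤ f y + c x y) → ∫ x, Real.exp (g x) ∂μ ≤ Real.exp (∫ x, f x ∂μ)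

lemma HasExpMoments.prod {E E' : Type*} [NormedAddCommGroup E] [MeasurableSpace E] [BorelSpace E]
    [NormedAddCommGroup E'] [MeasurableSpace E'] [BorelSpace E'] [SecondCountableTopology E']
    {μ : Measure E} {ν : Measure E'} [SFinite ν] (hμ : HasExpMoments μ) (hν : HasExpMoments ν) :
    HasExpMoments (μ.prod ν) := fun K => by
  refine Integrable.mono' ((hμ |K|).mul_prod (hν |K|))
    (by fun_prop : Measurable _).aestronglyMeasurable (ae_of_all _ fun x => ?_)
  rw [Real.norm_of_nonneg (Real.exp_pos _).le, ← Real.exp_add, ← mul_add]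
  refine Real.exp_le_exp.2 (mul_le_mul (le_abs_self K) ?_ (norm_nonneg _) (abs_nonneg _))
  rw [Prod.norm_def]
  exact max_le (by linarith [norm_nonneg x.2]) (by linarith [norm_nonneg x.1])

lemma LipschitzWith.prodMk_const {E E' : Type*} [NormedAddCommGroup E] [NormedAddCommGroup E']
    {f : E × E' → ℝ} {K : ℝ≥0} (hf : LipschitzWith K f) (t : E') :
    LipschitzWith K fun x => f (x, t) := by
  simpa [Function.comp_def] using hf.comp (LipschitzWith.prodMk_right t)

lemma LipschitzWith.integral_left {E E' : Type*} [NormedAddCommGroup E] [MeasurableSpace E]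
    [BorelSpace E] [NormedAddCommGroup E'] {μ : Measure E} [IsProbabilityMeasure μ]
    (hμ : HasExpMoments μ) {f : E × E' → ℝ} {K : ℝ≥0}
    (hf : LipschitzWith K f) : LipschitzWith K fun t => ∫ x, f (x, t) ∂μ := by
  refine LipschitzWith.of_le_add_mul _ fun s t => ?_
  have hi : ∀ t, Integrable (fun x => f (x, t)) μ := fun t => hμ.integrable (hf.prodMk_const t)
  calc ∫ x, f (x, s) ∂μ ≤ ∫ x, (f (x, t) + K * dist s t) ∂μ := by
        refine integral_mono (hi s) ((hi t).add (integrable_const _)) fun x => ?_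
        simpa [Prod.dist_eq] using hf.le_add_mul (x, s) (x, t)
    _ = _ := by rw [integral_add (hi t) (integrable_const _)]; simp

/-- Moving `t` multiplies the integrand by at most `exp (K * dist s t)`. This makes the partial
log-integral admissible in the second factor's inequality. -/
lemma LipschitzWith.log_integral_exp_left {E E' : Type*} [NormedAddCommGroup E] [MeasurableSpace E]
    [BorelSpace E] [NormedAddCommGroup E'] {μ : Measure E} [IsProbabilityMeasure μ]
    (hμ : HasExpMoments μ) {g : E × E' → ℝ} {K : ℝ≥0}
    (hg : LipschitzWith K g) :
    LipschitzWith K fun t => Real.log (∫ x, Real.exp (g (x, t)) ∂μ) := by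
  refine LipschitzWith.of_le_add_mul _ fun s t => ?_
  have hi : ∀ t, Integrable (fun x => Real.exp (g (x, t))) μ :=
    fun t => hμ.integrable_exp (hg.prodMk_const t)
  have hpos : ∀ t, 0 < ∫ x, Real.exp (g (x, t)) ∂μ := fun t => integral_exp_pos (hi t)
  rw [Real.log_le_iff_le_exp (hpos s), Real.exp_add, Real.exp_log (hpos t),
    ← integral_mul_const]
  refine integral_mono (hi s) ((hi t).mul_const _) fun x => ?_
  simp only [← Real.exp_add]
  refine Real.exp_le_exp.2 ?_
  simpa [Prod.dist_eq] using hg.le_add_mul (x, s) (x, t)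

/-- The infimum-convolution inequality tensorizes. -/
lemma InfConvIneq.prod {E E' : Type*} [NormedAddCommGroup E] [MeasurableSpace E] [BorelSpace E]
    [SecondCountableTopology E] [NormedAddCommGroup E'] [MeasurableSpace E'] [BorelSpace E']
    [SecondCountableTopology E'] {μ : Measure E} {ν : Measure E'} [IsProbabilityMeasure μ]
    [IsProbabilityMeasure ν] {c : E → E → ℝ} {c' : E' → E' → ℝ} (hμ : InfConvIneq μ c)
    (hν : InfConvIneq ν c') (eμ : HasExpMoments μ) (eν : HasExpMoments ν) :
    InfConvIneq (μ.prod ν) fun x y => c x.1 y.1 + c' x.2 y.2 := by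
  intro f g K hf hg hfg
  have hgi : ∀ t, Integrable (fun x => Real.exp (g (x, t))) μ :=
    fun t => eμ.integrable_exp (hg.prodMk_const t)
  have hfi : ∀ t, Integrable (fun x => f (x, t)) μ := fun t => eμ.integrable (hf.prodMk_const t)
  -- The hypothesis for `ν` at `(s, t)` is the inequality for `μ` on the slices `f (·, t) + c' s t`
  -- and `g (·, s)`.
  have key := hν (fun t => ∫ x, f (x, t) ∂μ) (fun t => Real.log (∫ x, Real.exp (g (x, t)) ∂μ)) K
    (hf.integral_left eμ) (hg.log_integral_exp_left eμ) fun s t => by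
      rw [Real.log_le_iff_le_exp (integral_exp_pos (hgi s))]
      have := hμ (fun x => f (x, t) + c' s t) (fun x => g (x, s)) K
        (LipschitzWith.of_dist_le_mul fun x y => by
          simpa using (hf.prodMk_const t).dist_le_mul x y) (hg.prodMk_const s)
        fun x y => by linarith [hfg (x, s) (y, t)]
      rw [integral_add (hfi t) (integrable_const _)] at this
      simpa using this
  simp_rw [Real.exp_log (integral_exp_pos (hgi _))] at key
  rwa [integral_prod_symm _ ((eμ.prod eν).integrable_exp hg),
    integral_prod_symm _ ((eμ.prod eν).integrable hf)]

lemma HasExpMoments.of_measurePreserving {E E' : Type*} [NormedAddCommGroup E]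
    [MeasurableSpace E] [BorelSpace E] [NormedAddCommGroup E'] [MeasurableSpace E'] [BorelSpace E'] {μ : Measure E} {ν : Measure E'}
    {φ : E → E'} {C : ℝ≥0} (hμ : HasExpMoments μ) (h : MeasurePreserving φ μ ν)
    (hφ : LipschitzWith C φ) : HasExpMoments ν := fun K => by
  rw [← h.map_eq, integrable_map_measure (by fun_prop : Measurable _).aestronglyMeasurable
    h.measurable.aemeasurable]
  have hm := h.measurable
  refine Integrable.mono' ((hμ (|K| * C)).const_mul (Real.exp (|K| * ‖φ 0‖)))
    (by fun_prop : Measurable _).aestronglyMeasurable (ae_of_all _ fun x => ?_)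
  simp only [Function.comp_apply]
  rw [Real.norm_of_nonneg (Real.exp_pos _).le, ← Real.exp_add, mul_assoc, ← mul_add]
  refine Real.exp_le_exp.2 (mul_le_mul (le_abs_self K) ?_ (norm_nonneg _) (abs_nonneg _))
  have h1 := hφ.norm_sub_le x 0
  rw [sub_zero] at h1
  linarith [norm_le_norm_add_norm_sub' (φ x) (φ 0)]

/-- Pull `f` and `g` back along `φ`. Lipschitz constants do not enter the conclusion, so passing
from sup norms to the Euclidean norm costs nothing: only the cost must be respected. -/
lemma InfConvIneq.of_measurePreserving {E E' : Type*} [NormedAddCommGroup E] [MeasurableSpace E]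
    [NormedAddCommGroup E'] [MeasurableSpace E'] [BorelSpace E'] {μ : Measure E} {ν : Measure E'}
    {φ : E → E'} {C : ℝ≥0} 
    {c : E → E → ℝ} {c' : E' → E' → ℝ} (hμ : InfConvIneq μ c)
    (h : MeasurePreserving φ μ ν) (hφ : LipschitzWith C φ)
    (hc : ∀ x y, c' (φ x) (φ y) ≤ c x y) : InfConvIneq ν c' := by
  intro f g K hf hg hfg
  have hfc := hf.continuous
  have hgc := hg.continuous
  rw [← h.map_eq, integral_map h.measurable.aemeasurable
      (by fun_prop : Measurable _).aestronglyMeasurable,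
    integral_map h.measurable.aemeasurable (by fun_prop : Measurable _).aestronglyMeasurable]
  exact hμ (fun x => f (φ x)) (fun x => g (φ x)) (K * C) (hf.comp hφ) (hg.comp hφ)
    fun x y => (hfg _ _).trans (by linarith [hc x y])

/-! ### Standard Gaussian measure in dimension `k` -/

lemma infConvIneq_gaussianReal : InfConvIneq (gaussianReal 0 1) fun x y => (x - y) ^ 2 / 2 :=
  fun _ _ _ hf hg hfg => integral_exp_le_of_infConv_gaussianReal hf hg hfg

lemma infConvIneq_pi_gaussianReal (k : ℕ) :
    HasExpMoments (Measure.pi fun _ : Fin k => gaussianReal 0 1) ∧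
    InfConvIneq (Measure.pi fun _ : Fin k => gaussianReal 0 1)
      fun x y => ∑ i, (x i - y i) ^ 2 / 2 := by
  induction k with
  | zero =>
    rw [Measure.pi_of_empty _ 0]
    refine ⟨fun K => integrable_dirac (by simp), fun f g K _ _ hfg => ?_⟩
    simpa using hfg 0 0
  | succ k ih =>
    have hmp := (measurePreserving_piFinSuccAbove
      (fun _ : Fin (k + 1) => gaussianReal 0 1) 0).symm
    have hl : LipschitzWith 1
        (MeasurableEquiv.piFinSuccAbove (fun _ : Fin (k + 1) => ℝ) 0).symm := by
      refine LipschitzWith.of_dist_le_mul fun x y => ?_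
      rw [NNReal.coe_one, one_mul, dist_pi_le_iff dist_nonneg]
      intro i
      refine Fin.cases ?_ (fun j => ?_) i
      · exact le_max_left _ _
      · exact (dist_le_pi_dist x.2 y.2 j).trans (le_max_right _ _)
    refine ⟨(hasExpMoments_gaussianReal.prod ih.1).of_measurePreserving hmp hl,
      (infConvIneq_gaussianReal.prod ih.2 hasExpMoments_gaussianReal
        ih.1).of_measurePreserving hmp hl fun x y => ?_⟩
    rw [Fin.sum_univ_succ]
    exact le_of_eq rfl

lemma infConvIneq_stdGaussian (k : ℕ) :
    HasExpMoments (stdGaussian (EuclideanSpace ℝ (Fin k))) ∧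
    InfConvIneq (stdGaussian (EuclideanSpace ℝ (Fin k))) fun x y => ‖x - y‖ ^ 2 / 2 := by
  have hmp : MeasurePreserving (WithLp.toLp 2) (Measure.pi fun _ : Fin k => gaussianReal 0 1)
      (stdGaussian (EuclideanSpace ℝ (Fin k))) := ⟨by fun_prop, map_pi_eq_stdGaussian⟩
  have hl := PiLp.lipschitzWith_toLp 2 (fun _ : Fin k => ℝ)
  refine ⟨(infConvIneq_pi_gaussianReal k).1.of_measurePreserving hmp hl,
    (infConvIneq_pi_gaussianReal k).2.of_measurePreserving hmp hl fun x y => ?_⟩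
  rw [EuclideanSpace.real_norm_sq_eq, Finset.sum_div]
  simp

/-! ### Concentration for Lipschitz functions -/

/-- For each pair of points the admissible constants form a closed set, which therefore contains the
infimum. -/
lemma lipschitzWith_lipConst {k : ℕ} {F : EuclideanSpace ℝ (Fin k) → ℝ}
    (hF : ∃ K : ℝ≥0, LipschitzWith K F) : LipschitzWith (lipConst F) F := by
  refine LipschitzWith.of_dist_le_mul fun x y => ?_
  have hcl : IsClosed {K : ℝ≥0 | dist (F x) (F y) ≤ K * dist x y} :=
    isClosed_le (by fun_prop) (by fun_prop)
  have hmem : lipConst F ∈ closure {K : ℝ≥0 | LipschitzWith K F} :=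
    csInf_mem_closure hF (OrderBot.bddBelow _)
  exact closure_minimal (fun K hK => hK.dist_le_mul x y) hcl hmem

/-- Gaussian concentration with the sharp constant. -/
lemma hasSubgaussianMGF_stdGaussian {k : ℕ} {F : EuclideanSpace ℝ (Fin k) → ℝ} {K : ℝ≥0}
    (hF : LipschitzWith K F) :
    HasSubgaussianMGF (fun x => F x - ∫ y, F y ∂stdGaussian (EuclideanSpace ℝ (Fin k))) (K ^ 2)
      (stdGaussian (EuclideanSpace ℝ (Fin k))) := by
  obtain ⟨hexp, hconv⟩ := infConvIneq_stdGaussian k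
  set m := ∫ y, F y ∂stdGaussian (EuclideanSpace ℝ (Fin k))
  have hlip : ∀ u b : ℝ, LipschitzWith (‖u‖₊ * K) fun x => u * F x - b := fun u b => by
    refine LipschitzWith.of_dist_le_mul fun x y => ?_
    rw [Real.dist_eq, sub_sub_sub_cancel_right, ← mul_sub, abs_mul, NNReal.coe_mul, mul_assoc,
      coe_nnnorm, Real.norm_eq_abs]
    exact mul_le_mul_of_nonneg_left (hF.dist_le_mul x y) (abs_nonneg u)
  refine ⟨fun u => ?_, fun u => ?_⟩
  · simpa [mul_sub] using hexp.integrable_exp (hlip u (u * m))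
  -- The shift `K² u² / 2` is the maximum of `|u| K r - r² / 2` over `r = ‖x - y‖`.
  · have h := hconv (fun x => u * F x - u * m) (fun x => u * F x - (u * m + K ^ 2 * u ^ 2 / 2))
      (‖u‖₊ * K) (hlip u _) (hlip u _) fun x y => by
        have h1 : u * (F x - F y) ≤ |u| * (K * ‖x - y‖) := (le_abs_self _).trans (by
          rw [abs_mul]
          exact mul_le_mul_of_nonneg_left (hF.abs_sub_le_mul_norm x y) (abs_nonneg u))
        nlinarith [sq_nonneg (|u| * K - ‖x - y‖), sq_abs u]
    have h0 : ∫ x, (u * F x - u * m) ∂stdGaussian (EuclideanSpace ℝ (Fin k)) = 0 := by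
      rw [integral_sub ((hexp.integrable hF).const_mul u) (integrable_const _),
        integral_const_mul]
      simp [m]
    rw [h0, Real.exp_zero] at h
    simp_rw [← sub_sub, ← mul_sub, Real.exp_sub _ ((K : ℝ) ^ 2 * u ^ 2 / 2)] at h
    rw [integral_div, div_le_one (Real.exp_pos _)] at h
    simpa [mgf] using h

/-- Two-sided Chernoff bound for a sub-Gaussian random variable. -/
lemma ProbabilityTheory.HasSubgaussianMGF.measureReal_lt_abs_le {Ω : Type*} [MeasurableSpace Ω]
    {P : Measure Ω} [IsFiniteMeasure P] {Y : Ω → ℝ} {c : ℝ≥0} (h : HasSubgaussianMGF Y c P)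
    {τ : ℝ} (hτ : 0 ≤ τ) :
    P.real {ω | τ < |Y ω|} ≤ 2 * Real.exp (-(τ ^ 2 / (2 * c))) := by
  have h1 := h.measure_ge_le hτ
  have h2 := h.neg.measure_ge_le hτ
  calc P.real {ω | τ < |Y ω|} ≤ P.real ({ω | τ ≤ Y ω} ∪ {ω | τ ≤ (-Y) ω}) :=
        measureReal_mono fun ω hω => (lt_abs.1 hω).imp (fun h => h.le) (fun h => show τ ≤ -Y ω from h.le)
    _ ≤ _ := measureReal_union_le _ _
    _ ≤ _ := by rw [← neg_div]; linarith

/-! ### Optimality of the constant -/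

/-- On `(τ, τ + 1]` the density is least at the right end. The loss in the exponent is only linear
in `τ`, harmless for the rate. -/
lemma exp_le_gaussianReal_tail {τ : ℝ} (hτ : 0 ≤ τ) :
    (√(2 * Real.pi))⁻¹ * Real.exp (-((τ + 1) ^ 2 / 2)) ≤ (gaussianReal 0 1).real {x | τ < |x|} := by
  have hsub : Ioc τ (τ + 1) ⊆ {x : ℝ | τ < |x|} := fun x hx => hx.1.trans_le (le_abs_self x)
  refine le_trans ?_ (measureReal_mono hsub)
  have h0 : (gaussianReal 0 1).real (Ioc τ (τ + 1)) =
      ∫ x in Ioc τ (τ + 1), gaussianPDFReal 0 1 x := by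
    rw [measureReal_def, gaussianReal_apply_eq_integral _ one_ne_zero, ENNReal.toReal_ofReal]
    exact setIntegral_nonneg measurableSet_Ioc fun x _ => gaussianPDFReal_nonneg _ _ _
  rw [h0]
  calc _ = ∫ _ in Ioc τ (τ + 1), (√(2 * Real.pi))⁻¹ * Real.exp (-((τ + 1) ^ 2 / 2)) := by simp
    _ ≤ _ := by
      refine setIntegral_mono_on (integrableOn_const (by simp))
        (integrable_gaussianPDFReal 0 1).integrableOn measurableSet_Ioc fun x hx => ?_
      rw [gaussianPDFReal_zero_one]
      have : x ^ 2 ≤ (τ + 1) ^ 2 := pow_le_pow_left₀ (hτ.trans hx.1.le) hx.2 2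
      gcongr

lemma le_half_of_gaussianReal_tail_le {C : ℝ}
    (h : ∀ τ : ℝ, 0 < τ → (gaussianReal 0 1).real {x | τ < |x|} ≤ 2 * Real.exp (-(C * τ ^ 2))) :
    C ≤ 1 / 2 := by
  by_contra! hC
  set M := Real.log (2 * √(2 * Real.pi)) with hM
  have hs : 0 < √(2 * Real.pi) := by positivity
  have hb : ∀ τ : ℝ, 0 < τ → C * τ ^ 2 - (τ + 1) ^ 2 / 2 ≤ M := fun τ hτ => by
    have h1 := (exp_le_gaussianReal_tail hτ.le).trans (h τ hτ)
    rw [hM, Real.le_log_iff_exp_le (by positivity), sub_eq_add_neg, Real.exp_add]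
    rw [Real.exp_neg (C * τ ^ 2), ← div_eq_mul_inv, le_div_iff₀ (Real.exp_pos _),
      mul_assoc, inv_mul_le_iff₀ hs] at h1
    linarith
  have hc : 0 < C - 1 / 2 := by linarith
  -- Chosen so that `(C - 1/2) τ` beats the linear loss `τ` by more than `1 + |M|`; the `+ 1`
  -- ensures `τ ≥ 1`, and `hb` fails.
  set τ := (2 + |M|) / (C - 1 / 2) + 1 with hτ
  have hτ1 : 1 ≤ τ := by
    have : 0 ≤ (2 + |M|) / (C - 1 / 2) := by positivity
    linarith
  have h2 : (C - 1 / 2) * τ = 2 + |M| + (C - 1 / 2) := by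
    rw [hτ, mul_add, mul_div_cancel₀ _ hc.ne', mul_one]
  have h3 := hb τ (by linarith)
  have h4 : C * τ ^ 2 - (τ + 1) ^ 2 / 2 = τ * (1 + |M| + (C - 1 / 2)) - 1 / 2 := by
    linear_combination τ * h2
  rw [h4] at h3
  nlinarith [le_abs_self M, abs_nonneg M, mul_le_mul_of_nonneg_right hτ1
    (by positivity : 0 ≤ 1 + |M| + (C - 1 / 2))]

lemma lipschitzWith_coord {k : ℕ} (i : Fin k) :
    LipschitzWith 1 fun x : EuclideanSpace ℝ (Fin k) => x i :=
  LipschitzWith.of_dist_le_mul fun x y => by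
    simpa [dist_eq_norm] using PiLp.norm_apply_le (x - y) i

lemma lipConst_coord {k : ℕ} (i : Fin k) :
    lipConst (fun x : EuclideanSpace ℝ (Fin k) => x i) = 1 := by
  refine le_antisymm (csInf_le (OrderBot.bddBelow _) (lipschitzWith_coord i))
    (le_csInf ⟨1, lipschitzWith_coord i⟩ fun K hK => ?_)
  have := LipschitzWith.dist_le_mul hK (EuclideanSpace.single i 1) 0
  simpa [Real.dist_eq] using this

lemma hasLaw_coord {k : ℕ} (i : Fin k) :
    HasLaw (fun x : EuclideanSpace ℝ (Fin k) => x i) (gaussianReal 0 1)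
      (stdGaussian (EuclideanSpace ℝ (Fin k))) := by
  refine ⟨by fun_prop, ?_⟩
  rw [← map_pi_eq_stdGaussian, Measure.map_map (by fun_prop) (by fun_prop)]
  exact (measurePreserving_eval (fun _ : Fin k => gaussianReal 0 1) i).map_eq

theorem mainTheorem1 (k : ℕ) {Ω : Type*} [MeasurableSpace Ω] (P : Measure Ω)
    [IsProbabilityMeasure P] (X : Ω → EuclideanSpace ℝ (Fin k))
    (hX : HasLaw X (stdGaussian (EuclideanSpace ℝ (Fin k))) P) :
    (∀ F : EuclideanSpace ℝ (Fin k) → ℝ, (∃ K : ℝ≥0, LipschitzWith K F) →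
      IsSubG (fun ω => F (X ω)) (lipConst F) P ∧
      (∀ τ : ℝ, 0 < τ →
        (0 < lipConst F →
          P.real {ω | τ < |F (X ω) - ∫ ω', F (X ω') ∂P|}
            ≤ 2 * Real.exp (-(τ ^ 2 / (2 * (lipConst F : ℝ) ^ 2)))) ∧
        (lipConst F = 0 → P {ω | τ < |F (X ω) - ∫ ω', F (X ω') ∂P|} = 0))) ∧
    (1 ≤ k → ∀ C : ℝ,
      (∀ F : EuclideanSpace ℝ (Fin k) → ℝ, (∃ K : ℝ≥0, LipschitzWith K F) → 0 < lipConst F →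
        ∀ τ : ℝ, 0 < τ →
          P.real {ω | τ < |F (X ω) - ∫ ω', F (X ω') ∂P|}
            ≤ 2 * Real.exp (-(C * τ ^ 2 / (lipConst F : ℝ) ^ 2))) ↔ C ≤ 1 / 2) := by
  have hmean : ∀ F : EuclideanSpace ℝ (Fin k) → ℝ, LipschitzWith (lipConst F) F →
      ∫ ω, F (X ω) ∂P = ∫ x, F x ∂stdGaussian (EuclideanSpace ℝ (Fin k)) := fun F hF =>
    hX.integral_comp hF.continuous.measurable.aestronglyMeasurable
  have hsub : ∀ F : EuclideanSpace ℝ (Fin k) → ℝ, LipschitzWith (lipConst F) F →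
      IsSubG (fun ω => F (X ω)) (lipConst F) P := fun F hF => by
    refine ⟨?_, ?_⟩
    · have := (infConvIneq_stdGaussian k).1.integrable hF
      rw [← hX.map_eq] at this
      exact this.comp_aemeasurable hX.aemeasurable
    · have := hasSubgaussianMGF_stdGaussian hF
      rw [← hmean F hF, ← hX.map_eq] at this
      exact HasSubgaussianMGF.of_map hX.aemeasurable this
  have htail : ∀ F : EuclideanSpace ℝ (Fin k) → ℝ, LipschitzWith (lipConst F) F →
      ∀ τ : ℝ, 0 < τ → P.real {ω | τ < |F (X ω) - ∫ ω', F (X ω') ∂P|}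
        ≤ 2 * Real.exp (-(τ ^ 2 / (2 * (lipConst F : ℝ) ^ 2))) := fun F hF τ hτ => by
    simpa using (hsub F hF).2.measureReal_lt_abs_le hτ.le
  refine ⟨fun F hF => ?_, fun hk C => ⟨fun h => ?_, fun hC F hF hpos τ hτ => ?_⟩⟩
  · have hF' := lipschitzWith_lipConst hF
    refine ⟨hsub F hF', fun τ hτ => ⟨fun _ => htail F hF' τ hτ, fun h0 => ?_⟩⟩
    have hconst : ∀ x, F x = F 0 := fun x => by
      have := hF'.dist_le_mul x 0
      rw [h0, NNReal.coe_zero, zero_mul] at this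
      exact dist_le_zero.1 this
    simp [hconst, hτ.not_gt]
  · have hcoord := hasLaw_coord (⟨0, hk⟩ : Fin k)
    have hlaw := hcoord.fun_comp hX
    refine le_half_of_gaussianReal_tail_le fun τ hτ => ?_
    have := h (fun x => x ⟨0, hk⟩) ⟨1, lipschitzWith_coord _⟩ (by simp [lipConst_coord]) τ hτ
    rw [lipConst_coord, hlaw.integral_eq, integral_id_gaussianReal] at this
    simp only [sub_zero, NNReal.coe_one, one_pow, div_one] at this
    rwa [hlaw.measureReal_eq (p := fun x => τ < |x|)
      (measurableSet_lt (by fun_prop) (by fun_prop))] at this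
  · refine (htail F (lipschitzWith_lipConst hF) τ hτ).trans ?_
    have : (0 : ℝ) < lipConst F := hpos
    have hle : C * τ ^ 2 / (lipConst F : ℝ) ^ 2 ≤ τ ^ 2 / (2 * (lipConst F : ℝ) ^ 2) := by
      rw [← div_div, div_le_div_iff_of_pos_right (by positivity)]
      nlinarith [sq_nonneg τ]
    gcongr
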